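/- Let $S=S[0]\cdots S[n-1]$ be a string over the alphabet $\{0,\dots,\sigma-1\}$. For $0\le l\le r<n$, a \emph{mode} of $S[l..r]$ is a character whose number of occurrences in $S[l..r]$ is positive and maximal, and $f(l,r)$ denotes this maximal number of occurrences. The \emph{mode index set} $M(l,r)$ is the set of the rightmost positions in $[l,r]$ of the modes of $S[l..r]$: $M(l,r)=\{i\in[l,r] : S[i]\text{ is a mode of }S[l..r]\text{ and }S[i]\ne S[j]\text{ for all } i<j\le r\}$. Let $B[0],\dots,B[n-1]$ be the bit-vectors of length $n$ with $B[i][j]=1$ iff $i\le j$ and $S[j]$ is a mode of $S[i..j]$. (a) For every string $S$ and all $0\le l\le r<n$, $M(l,r)=\{x : l\le x\le r,\ f(l,x)=f(l,r),\ B[l][x]=1\}$. (b) There is a data structure of $O(n^2)$ bits which, in addition to the string $S$, allows one to compute the mode index set $M(l,r)$ of any query $0\le l\le r<n$ in $O(|M(l,r)|)$ time on a word RAM with words of $\Theta(\log n)$ bits. Precisely, (b) says: there are one word-RAM program $P$ (a finite list of instructions: constants, arithmetic modulo $2^w$ including multiplication and division, bitwise operations, shifts, memory reads and writes, jumps, output,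 halt; unit cost each) and a constant $T$ such that for every $\kappa$ there is a constant $c$ such that for all $n$, all word sizes $w$ with $2\lfloor\log_2 n\rfloor+10\le w\le\kappa(\lfloor\log_2 n\rfloor+1)$ (with the convention $\lfloor\log_2 0\rfloor=0$), all $\sigma\le 2^w$ and all strings $S$ of length $n$ over $\{0,\dots,\sigma-1\}$, there is a sequence $D$ of $w$-bit words, of at most $c\,n^2$ bits in total, with the following property: for all $0\le l\le r<n$, the program $P$, started with $l,r,n$ in three registers and zero in all others and with a memory consisting of exactly $S$ (one character per word) followed by $D$, halts after at most $T\cdot|M(l,r)|$ steps, having output each element of $M(l,r)$ exactly once and nothing else, with the memory in its initial state. -/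

import Mathlib

namespace RangeMode

/-! ### Modes of ranges of a string -/

section Modes

variable {α : Type*} [DecidableEq α] {n : ℕ}

/-- The multiset `{S[l], S[l+1], …, S[r]}`. -/
def rangeMultiset (S : Fin n → α) (l r : Fin n) : Multiset α :=
  (Finset.Icc l r).val.map S

/-- `x` is a mode of the multiset `M`: it belongs to `M`, and its multiplicity is no smaller than
that of any other element. -/
def IsMode (M : Multiset α) (x : α) : Prop :=
  x ∈ M ∧ ∀ y ∈ M, M.count y ≤ M.count x

instance (M : Multiset α) (x : α) : Decidable (IsMode M x) := by
  unfold IsMode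
  infer_instance

/-- `f(l, r)`: the frequency of the modes of `S[l..r]`, i.e. the largest multiplicity in it. -/
def modeFreq (S : Fin n → α) (l r : Fin n) : ℕ :=
  (Finset.Icc l r).sup fun j => (rangeMultiset S l r).count (S j)

/-- The mode index set of the query `[l, r]`: the rightmost position in `[l, r]` of each mode of
`S[l..r]`. -/
def modeIndexSet (S : Fin n → α) (l r : Fin n) : Finset (Fin n) :=
  (Finset.Icc l r).filter fun i =>
    IsMode (rangeMultiset S l r) (S i) ∧ ∀ j ∈ Finset.Ioc i r, S i ≠ S j

/-- The bit-vectors `B[0], …, B[n-1]`: `B[i][j] = 1` iff `i ≤ j` and `S[j]` is a mode of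
`S[i..j]`. -/
def modeBit (S : Fin n → α) (i j : Fin n) : Bool :=
  decide (i ≤ j ∧ IsMode (rangeMultiset S i j) (S j))

end Modes

/-! ### The word RAM -/

/-- Binary operations on machine words. Arithmetic is modulo `2 ^ w`. -/
inductive BinOp where
  | add | sub | mul | div | mod | and | or | xor | shl | shr

/-- The value of a binary operation on words of `w` bits (`div` by zero gives zero). -/
def BinOp.eval {w : ℕ} : BinOp → BitVec w → BitVec w → BitVec w
  | .add, a, b => a + b
  | .sub, a, b => a - b
  | .mul, a, b => a * b
  | .div, a, b => a / b
  | .mod, a, b => a % b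
  | .and, a, b => a &&& b
  | .or, a, b => a ||| b
  | .xor, a, b => a ^^^ b
  | .shl, a, b => a <<< b
  | .shr, a, b => a >>> b

/-- Instructions of a word RAM. Registers and program positions are natural numbers; a program
mentions only finitely many of them. -/
inductive Instr where
  /-- `reg d := k` -/
  | const (d k : ℕ)
  /-- `reg d := op (reg a) (reg b)` -/
  | bin (op : BinOp) (d a b : ℕ)
  /-- `reg d := mem (reg a)` -/
  | load (d a : ℕ)
  /-- `mem (reg a) := reg b` -/
  | store (a b : ℕ)
  /-- go to position `t` -/
  | jump (t : ℕ)
  /-- go to position `t` if `reg a = reg b` -/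
  | jumpEq (a b t : ℕ)
  /-- go to position `t` if `reg a < reg b` as unsigned integers -/
  | jumpLt (a b t : ℕ)
  /-- append `reg a` to the output -/
  | out (a : ℕ)
  /-- stop -/
  | halt

/-- A program is a finite list of instructions. It does not depend on the word size. -/
abbrev Program := List Instr

/-- A configuration of the word RAM with words of `w` bits: program counter, registers, the main
memory (a finite array of words), and the words output so far. -/
structure State (w : ℕ) where
  pc : ℕ
  reg : ℕ → BitVec w
  mem : List (BitVec w)
  out : List (BitVec w)

/-- Write the word `v` into register `d` and go on to the next instruction. -/
def State.write {w : ℕ} (s : State w) (d : ℕ) (v : BitVec w) : State w :=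
  { s with pc := s.pc + 1, reg := Function.update s.reg d v }

/-- The effect of one instruction; `none` if the machine stops (`halt`) or crashes (a memory
access outside of the memory). -/
def Instr.exec {w : ℕ} (s : State w) : Instr → Option (State w)
  | .const d k => some (s.write d (BitVec.ofNat w k))
  | .bin op d a b => some (s.write d (op.eval (s.reg a) (s.reg b)))
  | .load d a => (s.mem[(s.reg a).toNat]?).map fun v => s.write d v
  | .store a b =>
      if (s.reg a).toNat < s.mem.length then
        some { s with pc := s.pc + 1, mem := s.mem.set (s.reg a).toNat (s.reg b) }
      else none
  | .jump t => some { s with pc := t }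
  | .jumpEq a b t => some { s with pc := if s.reg a = s.reg b then t else s.pc + 1 }
  | .jumpLt a b t =>
      some { s with pc := if (s.reg a).toNat < (s.reg b).toNat then t else s.pc + 1 }
  | .out a => some { s with pc := s.pc + 1, out := s.out ++ [s.reg a] }
  | .halt => none

/-- One step of the program `P`; each instruction counts as one step. -/
def step {w : ℕ} (P : Program) (s : State w) : Option (State w) :=
  (P[s.pc]?).bind fun i => i.exec s

/-- The configuration after exactly `t` steps, if the machine has not stopped before. -/
def steps {w : ℕ} (P : Program) : ℕ → State w → Option (State w)
  | 0, s => some s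
  | t + 1, s => (step P s).bind (steps P t)

/-- Started in `s`, the program `P` reaches a `halt` instruction after exactly `t` steps, in the
configuration `s'`. -/
def HaltsIn {w : ℕ} (P : Program) (s : State w) (t : ℕ) (s' : State w) : Prop :=
  steps P t s = some s' ∧ P[s'.pc]? = some Instr.halt

/-- The main memory that holds the input string (one character per word, from address `0` on)
followed by the words `D` of the index (from address `n` on), and nothing else. -/
def memory {n σ : ℕ} (w : ℕ) (S : Fin n → Fin σ) (D : List (BitVec w)) : List (BitVec w) :=
  List.ofFn (fun i => BitVec.ofNat w (S i : ℕ)) ++ D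

/-- The initial configuration for the query `[l, r]`: registers `0`, `1`, `2` hold `l`, `r` and
`n`, all other registers are zero, and nothing has been output. -/
def initState {n σ : ℕ} (w : ℕ) (S : Fin n → Fin σ) (D : List (BitVec w)) (l r : Fin n) :
    State w where
  pc := 0
  reg := fun k => BitVec.ofNat w
    (if k = 0 then (l : ℕ) else if k = 1 then (r : ℕ) else if k = 2 then n else 0)
  mem := memory w S D
  out := []

/-- With index `D` for the string `S`, the program `P` answers the query `[l, r]` in `t` steps: it
halts after `t` steps, has output every position of the mode index set exactly once and nothing
else, and leaves string and index as they were. -/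
def AnswersIn {n σ : ℕ} (w : ℕ) (P : Program) (S : Fin n → Fin σ) (D : List (BitVec w))
    (l r : Fin n) (t : ℕ) : Prop :=
  ∃ s' : State w, HaltsIn P (initState w S D l r) t s' ∧ s'.mem = memory w S D ∧
    s'.out.Nodup ∧
    ∀ v : ℕ, v ∈ s'.out.map BitVec.toNat ↔ ∃ x ∈ modeIndexSet S l r, (x : ℕ) = v

end RangeMode

/-! Part (a), `modeIndexSet_eq`: for `x` in `[l, r]`, the count of `S x` in `S[l..x]` is at most its
count in `S[l..r]` and at most `f(l, x)`, and both of these are at most `f(l, r)`. Either side of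
(a) says that equality holds throughout, because the two counts agree iff `x` is the last occurrence
of its character (`count_eq_iff`).

Part (b): `f(l, ·)` is nondecreasing, so the positions up to `r` with `f(l, x) = f(l, r)` form an
interval `[x₀, r]`, and the task is to list the ones of `B[l]` in it. Row `l` of the index is a set
of numbers below `2 * n`: odd elements are the ones of `B[l]`, even elements mark where `f(l, ·)`
takes a new value. Descending from `2 * r + 1` by predecessor steps, one meets exactly the answers
until the marker `2 * x₀` appears (`exists_isEvenPred`, `steps_loop`).

A predecessor costs constant time (`steps_pred`): rows are cut into blocks of about `log n` bits,
each with one word for its bits and one for the predecessor of its start; a shared table of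
logarithms finds the top bit inside a block. The index takes `O(n)` bits per row. Answers are
nonempty, which absorbs the fixed overhead. -/

namespace RangeMode

/-! ### Runs of the word RAM on registers given by natural numbers -/

section Machine

variable {w : ℕ} {P : Program} {mem : List (BitVec w)} {pc t : ℕ} {R : ℕ → ℕ}
  {o : List (BitVec w)}

/-- The configuration whose registers hold the natural numbers `R k`, reduced modulo `2 ^ w`. -/
def natState (mem : List (BitVec w)) (pc : ℕ) (R : ℕ → ℕ) (o : List (BitVec w)) : State w where
  pc := pc
  reg := fun k => BitVec.ofNat w (R k)
  mem := mem
  out := o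

theorem natState_write (d v : ℕ) :
    (natState mem pc R o).write d (BitVec.ofNat w v) =
      natState mem (pc + 1) (Function.update R d v) o := by
  simp only [State.write, natState, State.mk.injEq, true_and, and_true]
  funext k
  by_cases h : k = d
  · subst h; simp
  · simp [Function.update_of_ne h]

theorem steps_add (P : Program) (a b : ℕ) (s : State w) :
    steps P (a + b) s = (steps P a s).bind (steps P b) := by
  induction a generalizing s with
  | zero => simp [steps]
  | succ a ih =>
    rw [Nat.add_right_comm]
    simp only [steps]
    cases step P s with
    | none => rfl
    | some s' => simpa using ih s'

theorem steps_trans {a b : ℕ} {s s' s'' : State w} (h : steps P a s = some s')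
    (h' : steps P b s' = some s'') : steps P (a + b) s = some s'' := by
  rw [steps_add, h, Option.bind_some, h']

theorem steps_succ_of_exec {i : Instr} {s' : State w} (h : P[pc]? = some i)
    (h' : i.exec (natState mem pc R o) = some s') :
    steps P (t + 1) (natState mem pc R o) = steps P t s' := by
  have h'' : step P (natState mem pc R o) = some s' := by
    rw [← h']
    change (P[pc]?).bind _ = _
    rw [h, Option.bind_some]
  simp [steps, h'']

theorem steps_const {d k : ℕ} (h : P[pc]? = some (.const d k)) :
    steps P (t + 1) (natState mem pc R o) =
      steps P t (natState mem (pc + 1) (Function.update R d k) o) := by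
  rw [← natState_write]
  apply steps_succ_of_exec h
  simp [Instr.exec]

theorem steps_bin {op : BinOp} {d a b : ℕ} (v : ℕ) (h : P[pc]? = some (.bin op d a b))
    (hv : op.eval (BitVec.ofNat w (R a)) (BitVec.ofNat w (R b)) = BitVec.ofNat w v) :
    steps P (t + 1) (natState mem pc R o) =
      steps P t (natState mem (pc + 1) (Function.update R d v) o) := by
  rw [← natState_write, ← hv]
  apply steps_succ_of_exec h
  simp [Instr.exec, natState]

theorem steps_load {d a : ℕ} (x v : ℕ) (h : P[pc]? = some (.load d a)) (hx : R a = x)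
    (hw : x < 2 ^ w) (hv : mem[x]? = some (BitVec.ofNat w v)) :
    steps P (t + 1) (natState mem pc R o) =
      steps P t (natState mem (pc + 1) (Function.update R d v) o) := by
  rw [← natState_write]
  apply steps_succ_of_exec h
  have h'' : (natState mem pc R o).mem[((natState mem pc R o).reg a).toNat]? =
      some (BitVec.ofNat w v) := by
    simp [natState, hx, Nat.mod_eq_of_lt hw, hv]
  simp [Instr.exec, h'']

theorem steps_jump {q : ℕ} (h : P[pc]? = some (.jump q)) :
    steps P (t + 1) (natState mem pc R o) = steps P t (natState mem q R o) := by
  apply steps_succ_of_exec h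
  simp [Instr.exec, natState]

theorem steps_jumpEq {a b q : ℕ} (x y : ℕ) (h : P[pc]? = some (.jumpEq a b q)) (hx : R a = x)
    (hy : R b = y) (hxw : x < 2 ^ w) (hyw : y < 2 ^ w) :
    steps P (t + 1) (natState mem pc R o) =
      steps P t (natState mem (if x = y then q else pc + 1) R o) := by
  apply steps_succ_of_exec h
  have h'' : (BitVec.ofNat w x = BitVec.ofNat w y) ↔ x = y := by
    rw [← BitVec.toNat_inj]
    simp [Nat.mod_eq_of_lt hxw, Nat.mod_eq_of_lt hyw]
  simp [Instr.exec, natState, hx, hy, h'']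

theorem steps_out {a : ℕ} (x : ℕ) (h : P[pc]? = some (.out a)) (hx : R a = x) :
    steps P (t + 1) (natState mem pc R o) =
      steps P t (natState mem (pc + 1) R (o ++ [BitVec.ofNat w x])) := by
  apply steps_succ_of_exec h
  simp [Instr.exec, natState, hx]

variable {d a b : ℕ} (x y : ℕ)

/-- Reduction modulo `2 ^ w` respects sums and products, so these need no bounds; the operations
below do. -/
theorem steps_bin_add (h : P[pc]? = some (.bin .add d a b)) (hx : R a = x) (hy : R b = y) :
    steps P (t + 1) (natState mem pc R o) =
      steps P t (natState mem (pc + 1) (Function.update R d (x + y)) o) :=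
  steps_bin _ h (by rw [hx, hy, BitVec.ofNat_add, BinOp.eval])

theorem steps_bin_mul (h : P[pc]? = some (.bin .mul d a b)) (hx : R a = x) (hy : R b = y) :
    steps P (t + 1) (natState mem pc R o) =
      steps P t (natState mem (pc + 1) (Function.update R d (x * y)) o) :=
  steps_bin _ h (by rw [hx, hy, BitVec.ofNat_mul, BinOp.eval])

theorem steps_bin_sub (h : P[pc]? = some (.bin .sub d a b)) (hx : R a = x) (hy : R b = y)
    (hyw : y < 2 ^ w) (hyx : y ≤ x) :
    steps P (t + 1) (natState mem pc R o) =
      steps P t (natState mem (pc + 1) (Function.update R d (x - y)) o) :=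
  steps_bin _ h (by rw [hx, hy, BinOp.eval, BitVec.ofNat_sub_ofNat_of_le _ _ hyw hyx])

theorem steps_bin_div (h : P[pc]? = some (.bin .div d a b)) (hx : R a = x) (hy : R b = y)
    (hxw : x < 2 ^ w) (hyw : y < 2 ^ w) :
    steps P (t + 1) (natState mem pc R o) =
      steps P t (natState mem (pc + 1) (Function.update R d (x / y)) o) := by
  refine steps_bin _ h ?_
  rw [hx, hy, BinOp.eval, ← BitVec.toNat_inj]
  simp [Nat.mod_eq_of_lt hxw, Nat.mod_eq_of_lt hyw,
    Nat.mod_eq_of_lt ((Nat.div_le_self x y).trans_lt hxw)]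

theorem steps_bin_mod (h : P[pc]? = some (.bin .mod d a b)) (hx : R a = x) (hy : R b = y)
    (hxw : x < 2 ^ w) (hyw : y < 2 ^ w) :
    steps P (t + 1) (natState mem pc R o) =
      steps P t (natState mem (pc + 1) (Function.update R d (x % y)) o) := by
  refine steps_bin _ h ?_
  rw [hx, hy, BinOp.eval, ← BitVec.toNat_inj]
  simp [Nat.mod_eq_of_lt hxw, Nat.mod_eq_of_lt hyw,
    Nat.mod_eq_of_lt ((Nat.mod_le x y).trans_lt hxw)]

theorem steps_bin_shl (h : P[pc]? = some (.bin .shl d a b)) (hx : R a = 1) (hy : R b = y)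
    (hyw : y < w) :
    steps P (t + 1) (natState mem pc R o) =
      steps P t (natState mem (pc + 1) (Function.update R d (2 ^ y)) o) := by
  refine steps_bin _ h ?_
  have hy' : y < 2 ^ w := hyw.trans w.lt_two_pow_self
  have h1 : 1 < 2 ^ w := Nat.one_lt_two_pow (by omega)
  rw [hx, hy, BinOp.eval, ← BitVec.toNat_inj]
  simp [Nat.mod_eq_of_lt hy', Nat.mod_eq_of_lt h1, Nat.shiftLeft_eq, ← Nat.pow_mod]

end Machine

/-! ### Predecessors in a set of natural numbers, block by block -/

section Predecessor

open Classical in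
/-- The largest element of `E` that is at most `y`, and `0` if there is none. -/
noncomputable def pred (E : ℕ → Prop) (y : ℕ) : ℕ :=
  Nat.findGreatest E y

open Classical in
/-- The characteristic bits of `E` on the block `[q * L, (q + 1) * L)`. -/
noncomputable def blockBits (E : ℕ → Prop) (L q : ℕ) : ℕ :=
  Nat.ofBits fun i : Fin L => decide (E (q * L + i))

theorem blockBits_lt (E : ℕ → Prop) (L q : ℕ) : blockBits E L q < 2 ^ L :=
  Nat.ofBits_lt_two_pow _

/-- The remainder masks off the positions above `j`, so its top bit is the predecessor inside the
block. -/
theorem testBit_blockBits_mod (E : ℕ → Prop) (L q j : ℕ) (hj : j < L) (i : ℕ) :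
    (blockBits E L q % 2 ^ (j + 1)).testBit i = true ↔ i ≤ j ∧ E (q * L + i) := by
  rw [Nat.testBit_mod_two_pow, Bool.and_eq_true, decide_eq_true_iff, Nat.lt_succ_iff]
  refine and_congr_right fun hi => ?_
  rw [blockBits, Nat.testBit_ofBits_lt _ _ (hi.trans_lt hj)]
  simp

theorem pred_le (E : ℕ → Prop) (y : ℕ) : pred E y ≤ y := by
  classical exact Nat.findGreatest_le y

theorem pred_eq {E : ℕ → Prop} {y z : ℕ} (hz : z ≤ y) (hE : E z)
    (h : ∀ x, z < x → x ≤ y → ¬ E x) : pred E y = z := by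
  classical exact Nat.findGreatest_eq_iff.2 ⟨hz, fun _ => hE, h⟩

theorem pred_spec {E : ℕ → Prop} {y z : ℕ} (hz : z ≤ y) (hE : E z) : E (pred E y) := by
  classical exact Nat.findGreatest_spec hz hE

theorem le_pred {E : ℕ → Prop} {y z : ℕ} (hz : z ≤ y) (hE : E z) : z ≤ pred E y := by
  classical exact Nat.le_findGreatest hz hE

theorem pred_of_block_ne_zero {E : ℕ → Prop} {L y : ℕ} (hL : 0 < L)
    (h : blockBits E L (y / L) % 2 ^ (y % L + 1) ≠ 0) :
    pred E y = y / L * L + (blockBits E L (y / L) % 2 ^ (y % L + 1)).log2 := by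
  have hj := Nat.mod_lt y hL
  have hy := Nat.div_add_mod' y L
  have hb := (testBit_blockBits_mod E L (y / L) (y % L) hj _).1 (Nat.testBit_log2 h)
  refine pred_eq (by omega) hb.2 fun x hx hxy hE => ?_
  have hbit := (testBit_blockBits_mod E L (y / L) (y % L) hj (x - y / L * L)).2
    ⟨by omega, by rwa [Nat.add_sub_cancel' (by omega)]⟩
  have := (Nat.le_log2 h).2 (Nat.ge_two_pow_of_testBit hbit)
  omega

/-- The search falls through to the end of the previous block. In the first block truncated
subtraction turns that end into `0`, and both sides are the default `0`. -/
theorem pred_of_block_eq_zero {E : ℕ → Prop} {L y : ℕ} (hL : 0 < L)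
    (h : blockBits E L (y / L) % 2 ^ (y % L + 1) = 0) :
    pred E y = pred E (y / L * L - 1) := by
  classical
  have hj := Nat.mod_lt y hL
  have hy := Nat.div_add_mod' y L
  have key : ∀ x, y / L * L ≤ x → x ≤ y → ¬ E x := fun x hx hxy hE => by
    have hbit := (testBit_blockBits_mod E L (y / L) (y % L) hj (x - y / L * L)).2
      ⟨by omega, by rwa [Nat.add_sub_cancel' hx]⟩
    simp [h] at hbit
  unfold pred
  have hs := (Nat.findGreatest_eq_iff (P := E) (k := y / L * L - 1)).1 rfl
  exact Nat.findGreatest_eq_iff.2 ⟨by omega, hs.2.1, fun x hx hxy =>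
    if hc : x ≤ y / L * L - 1 then hs.2.2 hx hc else key x (by omega) hxy⟩

end Predecessor

/-! ### The index and the query program -/

/-- The number of bits in a block of the index of a string of length `n`. -/
def blockLength (n : ℕ) : ℕ := Nat.log 2 n + 1

/-- The number of blocks in a row of the index of a string of length `n`. -/
def blockCount (n : ℕ) : ℕ := 2 * n / blockLength n + 1

/-- The words of the index: a table of binary logarithms (whose unused entry `0` holds the block
length), the bits of all blocks, and the predecessors of all blocks, interleaved. -/
noncomputable def indexWord (E : ℕ → ℕ → Prop) (n k : ℕ) : ℕ :=
  let L := blockLength n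
  let Q := blockCount n
  if k % 3 = 0 then if k = 0 then L else (k / 3).log2
  else if k % 3 = 1 then blockBits (E (k / 3 / Q)) L (k / 3 % Q)
  else pred (E (k / 3 / Q)) (k / 3 % Q * L - 1)

/-- The number of words of the index. -/
def indexLength (n : ℕ) : ℕ := 3 * (n * blockCount n + 2 * n)

/-- The index that stores the rows `E 0, …, E (n - 1)`. -/
noncomputable def index (E : ℕ → ℕ → Prop) (n w : ℕ) : List (BitVec w) :=
  List.ofFn fun k : Fin (indexLength n) => BitVec.ofNat w (indexWord E n k)

/-- The query program. With `y = 2 * r + 1` it runs through the elements of row `l` that are at most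
`y`, in descending order; it outputs `x` for an element `2 * x + 1`, and stops at the first even
element. -/
def queryProgram : Program :=
  [.const 3 1, .const 4 3, .load 5 2, .bin .add 6 2 2, .bin .div 6 6 5, .bin .add 6 6 3,
    .bin .mul 6 0 6, .bin .add 1 1 1, .bin .add 1 1 3,
    .bin .div 7 1 5, .bin .mod 8 1 5, .bin .add 9 6 7, .bin .mul 9 9 4, .bin .add 9 9 2,
    .bin .add 9 9 3, .load 10 9, .bin .add 8 8 3, .bin .shl 8 3 8, .bin .mod 10 10 8,
    .jumpEq 10 12 26,
    .bin .mul 10 10 4, .bin .add 10 10 2, .load 10 10, .bin .mul 7 7 5, .bin .add 1 7 10, .jump 28,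
    .bin .add 9 9 3, .load 1 9,
    .bin .add 13 3 3, .bin .mod 11 1 13, .jumpEq 11 12 35,
    .bin .div 11 1 13, .out 11, .bin .sub 1 1 3, .jump 9,
    .halt]

theorem indexWord_blockLength (E : ℕ → ℕ → Prop) (n : ℕ) : indexWord E n 0 = blockLength n := by
  simp [indexWord]

theorem indexWord_log (E : ℕ → ℕ → Prop) (n : ℕ) {v : ℕ} (hv : v ≠ 0) :
    indexWord E n (v * 3) = v.log2 := by
  simp [indexWord, hv]

theorem blockCount_pos (n : ℕ) : 0 < blockCount n := Nat.succ_pos _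

theorem block_div {n q : ℕ} (l : ℕ) (hq : q < blockCount n) :
    (l * blockCount n + q) / blockCount n = l := by
  rw [mul_comm, Nat.mul_add_div (blockCount_pos n), Nat.div_eq_of_lt hq, add_zero]

theorem block_mod {n q : ℕ} (l : ℕ) (hq : q < blockCount n) :
    (l * blockCount n + q) % blockCount n = q := by
  rw [mul_comm, Nat.mul_add_mod, Nat.mod_eq_of_lt hq]

theorem indexWord_bits (E : ℕ → ℕ → Prop) {n q : ℕ} (l : ℕ) (hq : q < blockCount n) :
    indexWord E n ((l * blockCount n + q) * 3 + 1) = blockBits (E l) (blockLength n) q := by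
  have h1 : ((l * blockCount n + q) * 3 + 1) % 3 = 1 := by omega
  have h2 : ((l * blockCount n + q) * 3 + 1) / 3 = l * blockCount n + q := by omega
  simp only [indexWord, h1, h2, block_div l hq, block_mod l hq]
  simp

theorem indexWord_pred (E : ℕ → ℕ → Prop) {n q : ℕ} (l : ℕ) (hq : q < blockCount n) :
    indexWord E n ((l * blockCount n + q) * 3 + 2) = pred (E l) (q * blockLength n - 1) := by
  have h1 : ((l * blockCount n + q) * 3 + 2) % 3 = 2 := by omega
  have h2 : ((l * blockCount n + q) * 3 + 2) / 3 = l * blockCount n + q := by omega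
  simp only [indexWord, h1, h2, block_div l hq, block_mod l hq]
  simp

/-- Block contents, read as numbers, stay below `2 * n`; this bounds the size of the logarithm
table. -/
theorem two_pow_blockLength_le {n : ℕ} (hn : n ≠ 0) : 2 ^ blockLength n ≤ 2 * n := by
  rw [blockLength, pow_succ, mul_comm]
  exact Nat.mul_le_mul_left _ (Nat.pow_log_le_self 2 hn)

theorem blockLength_le {n : ℕ} (hn : n ≠ 0) : blockLength n ≤ n :=
  Nat.log_lt_self 2 hn

theorem blockCount_le (n : ℕ) : blockCount n ≤ 2 * n + 1 :=
  Nat.succ_le_succ (Nat.div_le_self _ _)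

theorem block_lt_blockCount {n y : ℕ} (hy : y < 2 * n) : y / blockLength n < blockCount n :=
  Nat.lt_succ_of_le (Nat.div_le_div_right hy.le)

/-- Every memory address fits into a word, since the memory has `O(n ^ 2)` words. -/
theorem add_indexLength_lt {n w : ℕ} (hw : 2 * Nat.log 2 n + 10 ≤ w) :
    n + indexLength n < 2 ^ w := by
  have h1 : n < 2 ^ (Nat.log 2 n + 1) := Nat.lt_pow_succ_log_self one_lt_two n
  have h2 : 256 * (2 ^ (Nat.log 2 n + 1) * 2 ^ (Nat.log 2 n + 1)) ≤ 2 ^ w := by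
    calc _ = 2 ^ (2 * Nat.log 2 n + 10) := by ring
      _ ≤ _ := Nat.pow_le_pow_right two_pos hw
  have h3 := Nat.mul_le_mul h1 h1
  have h4 : n * blockCount n ≤ n * (2 * n + 1) := Nat.mul_le_mul_left _ (blockCount_le n)
  have h5 : n ≤ n * n := Nat.le_mul_self n
  simp only [indexLength]
  nlinarith

theorem index_length_mul_le {n w κ : ℕ} (E : ℕ → ℕ → Prop)
    (hw : w ≤ κ * (Nat.log 2 n + 1)) : (index E n w).length * w ≤ 15 * κ * n ^ 2 := by
  rcases eq_or_ne n 0 with rfl | hn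
  · simp [index, indexLength]
  have hL := blockLength_le hn
  have h1 : blockCount n * blockLength n ≤ 3 * n := by
    rw [blockCount, add_mul, one_mul]
    have := Nat.div_mul_le_self (2 * n) (blockLength n)
    omega
  rw [index, List.length_ofFn]
  calc indexLength n * w ≤ indexLength n * (κ * blockLength n) := Nat.mul_le_mul_left _ hw
    _ = 3 * κ * n * (blockCount n * blockLength n + 2 * blockLength n) := by
      rw [indexLength]; ring
    _ ≤ 3 * κ * n * (3 * n + 2 * n) := by gcongr
    _ = 15 * κ * n ^ 2 := by ring

theorem memory_index_getElem? {n σ w : ℕ} (S : Fin n → Fin σ) (E : ℕ → ℕ → Prop) {k : ℕ}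
    (hk : k < indexLength n) :
    (memory w S (index E n w))[n + k]? = some (BitVec.ofNat w (indexWord E n k)) := by
  rw [memory, List.getElem?_append_right (by simp)]
  simp [index, hk]

/-! ### Correctness and running time of the query program -/

section Query

variable {n σ w l : ℕ} (S : Fin n → Fin σ) (E : ℕ → ℕ → Prop)

/-- The contents of the registers during the main loop of the query program. -/
structure LoopRegs (n l y : ℕ) (R : ℕ → ℕ) : Prop where
  pos : R 1 = y
  len : R 2 = n
  one : R 3 = 1
  three : R 4 = 3
  block : R 5 = blockLength n
  row : R 6 = l * blockCount n
  zero : R 12 = 0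

theorem steps_prelude (hw : 2 * Nat.log 2 n + 10 ≤ w) (l r : Fin n) :
    ∃ R, LoopRegs n l (2 * r + 1) R ∧
      steps queryProgram 9 (initState w S (index E n w) l r) =
        some (natState (memory w S (index E n w)) 9 R []) := by
  have hn : 0 < n := l.pos
  have hlen := add_indexLength_lt hw
  have hL := blockLength_le hn.ne'
  have hN : 2 * n < 2 ^ w := by
    refine lt_of_le_of_lt ?_ hlen
    simp only [indexLength]; omega
  have hmem := memory_index_getElem? (w := w) S E (k := 0)
    (by simp only [indexLength]; omega)
  rw [indexWord_blockLength, add_zero] at hmem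
  refine ⟨?R, ?inv, ?run⟩
  case run =>
    -- Symbolic execution: each rewrite is one instruction, fetched from the concrete program by
    -- `rfl`.
    change steps queryProgram 9 (natState (memory w S (index E n w)) 0 (fun k =>
      if k = 0 then (l : ℕ) else if k = 1 then (r : ℕ) else if k = 2 then n else 0) []) = _
    rw [steps_const rfl, steps_const rfl,
      steps_load n (blockLength n) rfl (by simp) (by omega) hmem,
      steps_bin_add n n rfl (by simp) (by simp),
      steps_bin_div (n + n) (blockLength n) rfl (by simp) (by simp) (by omega) (by omega),
      steps_bin_add ((n + n) / blockLength n) 1 rfl (by simp) (by simp),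
      steps_bin_mul l ((n + n) / blockLength n + 1) rfl (by simp) (by simp),
      steps_bin_add r r rfl (by simp) (by simp),
      steps_bin_add (r + r) 1 rfl (by simp) (by simp), steps]
  case inv => constructor <;> simp [blockCount, two_mul]

theorem steps_pred (hw : 2 * Nat.log 2 n + 10 ≤ w) (hl : l < n) {y : ℕ} (hy : y < 2 * n)
    {R : ℕ → ℕ} (hR : LoopRegs n l y R) (o : List (BitVec w)) :
    ∃ R', LoopRegs n l (pred (E l) y) R' ∧ ∃ t ≤ 17,
      steps queryProgram t (natState (memory w S (index E n w)) 9 R o) =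
        some (natState (memory w S (index E n w)) 28 R' o) := by
  have hlen := add_indexLength_lt hw
  have hn : n ≠ 0 := by omega
  have hL := blockLength_le hn
  have hL0 : 0 < blockLength n := Nat.succ_pos _
  have hpow := two_pow_blockLength_le hn
  have hLw : blockLength n < w := by simp only [blockLength]; omega
  have hN : 2 * n < 2 ^ w := by
    refine lt_of_le_of_lt ?_ hlen
    simp only [indexLength]; omega
  have hq := block_lt_blockCount hy
  have hj := Nat.mod_lt y hL0
  obtain ⟨h1, h2, h3, h4, h5, h6, h12⟩ := hR
  have hb : l * blockCount n + y / blockLength n < n * blockCount n := by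
    calc _ < (l + 1) * blockCount n := by rw [add_mul, one_mul]; omega
      _ ≤ _ := Nat.mul_le_mul_right _ hl
  have hk : (l * blockCount n + y / blockLength n) * 3 + 2 < indexLength n := by
    simp only [indexLength]; omega
  have hm1 := memory_index_getElem? (w := w) S E
    (k := (l * blockCount n + y / blockLength n) * 3 + 1) (by omega)
  have hm2 := memory_index_getElem? (w := w) S E hk
  rw [indexWord_bits E l hq] at hm1
  rw [indexWord_pred E l hq] at hm2
  rw [← add_assoc, add_comm n] at hm1 hm2
  have hbits := blockBits_lt (E l) (blockLength n) (y / blockLength n)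
  set q := y / blockLength n with hqdef
  set j := y % blockLength n with hjdef
  set b := l * blockCount n + q with hbdef
  set B := blockBits (E l) (blockLength n) q with hBdef
  set v := B % 2 ^ (j + 1) with hvdef
  have hv : v ≤ B := Nat.mod_le _ _
  have hjw : 2 ^ (j + 1) < 2 ^ w := Nat.pow_lt_pow_right one_lt_two (by omega)
  -- The 11 instructions common to both cases: fetch the block of `y`, mask it, and branch on
  -- whether anything is left.
  have start : ∀ t, steps queryProgram (11 + t) (natState (memory w S (index E n w)) 9 R o) =
      steps queryProgram t (natState (memory w S (index E n w)) (if v = 0 then 26 else 20)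
        (Function.update (Function.update (Function.update (Function.update (Function.update
          (Function.update (Function.update (Function.update (Function.update (Function.update R
          7 q) 8 j) 9 b) 9 (b * 3)) 9 (b * 3 + n)) 9 (b * 3 + n + 1)) 10 B) 8 (j + 1))
          8 (2 ^ (j + 1))) 10 v) o) := by
    intro t
    rw [add_comm,
      steps_bin_div y (blockLength n) rfl (by simp [h1]) (by simp [h5]) (by omega) (by omega),
      steps_bin_mod y (blockLength n) rfl (by simp [h1]) (by simp [h5]) (by omega) (by omega),
      steps_bin_add (l * blockCount n) q rfl (by simp [h6]) (by simp [hqdef]),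
      steps_bin_mul b 3 rfl (by simp [hbdef]) (by simp [h4]),
      steps_bin_add (b * 3) n rfl (by simp) (by simp [h2]),
      steps_bin_add (b * 3 + n) 1 rfl (by simp) (by simp [h3]),
      steps_load (b * 3 + n + 1) B rfl (by simp) (by omega) hm1,
      steps_bin_add j 1 rfl (by simp [hjdef]) (by simp [h3]),
      steps_bin_shl (j + 1) rfl (by simp [h3]) (by simp) (by omega),
      steps_bin_mod B (2 ^ (j + 1)) rfl (by simp) (by simp) (by omega) hjw,
      steps_jumpEq v 0 rfl (by simp [hvdef]) (by simp [h12]) (by omega) (by omega)]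
  by_cases hv0 : v = 0
  · refine ⟨?R, ?inv, 11 + 2, by norm_num, ?run⟩
    case run =>
      rw [start, if_pos hv0,
        steps_bin_add (b * 3 + n + 1) 1 rfl (by simp) (by simp [h3]),
        steps_load (b * 3 + n + 1 + 1) (pred (E l) (q * blockLength n - 1)) rfl (by simp)
          (by omega) hm2, steps]
    case inv =>
      rw [pred_of_block_eq_zero hL0 hv0]
      constructor <;> simp [*]
  · have hm3 := memory_index_getElem? (w := w) S E (k := v * 3)
      (by simp only [indexLength]; omega)
    rw [indexWord_log E n hv0, add_comm n] at hm3
    have hvw : v * 3 + n < 2 ^ w := by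
      refine lt_of_le_of_lt ?_ hlen
      simp only [indexLength]; omega
    refine ⟨?R', ?inv', 11 + 6, by norm_num, ?run'⟩
    case run' =>
      rw [start, if_neg hv0,
        steps_bin_mul v 3 rfl (by simp) (by simp [h4]),
        steps_bin_add (v * 3) n rfl (by simp) (by simp [h2]),
        steps_load (v * 3 + n) v.log2 rfl (by simp) hvw hm3,
        steps_bin_mul q (blockLength n) rfl (by simp) (by simp [h5]),
        steps_bin_add (q * blockLength n) v.log2 rfl (by simp) (by simp),
        steps_jump rfl, steps]
    case inv' =>
      rw [pred_of_block_ne_zero hL0 hv0]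
      constructor <;> simp [*]

/-- `e` is the largest even element of `E` that is at most `y`. -/
structure IsEvenPred (E : ℕ → Prop) (y e : ℕ) : Prop where
  even : e % 2 = 0
  mem : E e
  le : e ≤ y
  odd : ∀ x, e < x → x ≤ y → E x → x % 2 = 1

/-- The element `e` is a sentinel: a predecessor always exists, so the default value of `pred` never
misleads. A round costs at most 17 steps for the predecessor, 3 for the parity test and 4 for output
and descent. -/
theorem steps_loop (hw : 2 * Nat.log 2 n + 10 ≤ w) (hl : l < n) {e : ℕ} (y : ℕ) (hy : y < 2 * n)
    (he : IsEvenPred (E l) y e) {R : ℕ → ℕ} (hR : LoopRegs n l y R) (o : List (BitVec w)) :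
    ∃ xs : List ℕ, xs.Nodup ∧ (∀ x, x ∈ xs ↔ e < 2 * x + 1 ∧ 2 * x + 1 ≤ y ∧ E l (2 * x + 1)) ∧
      ∃ R', ∃ t ≤ 24 * (xs.length + 1),
        steps queryProgram t (natState (memory w S (index E n w)) 9 R o) =
          some (natState (memory w S (index E n w)) 35 R' (o ++ xs.map (BitVec.ofNat w))) := by
  induction y using Nat.strong_induction_on generalizing R o with
  | _ y ih =>
  have hlen := add_indexLength_lt hw
  have hN : 2 * n < 2 ^ w := by
    refine lt_of_le_of_lt ?_ hlen
    simp only [indexLength]; omega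
  obtain ⟨R₁, hR₁, t₁, ht₁, hs₁⟩ := steps_pred S E hw hl hy hR o
  have hzle := pred_le (E l) y
  have hzE := pred_spec he.le he.mem
  have hez := le_pred he.le he.mem
  have hmax : ∀ x, x ≤ y → E l x → x ≤ pred (E l) y := fun x => le_pred
  set z := pred (E l) y
  obtain ⟨h1, h2, h3, h4, h5, h6, h12⟩ := hR₁
  have parity : ∀ t, steps queryProgram (3 + t) (natState (memory w S (index E n w)) 28 R₁ o) =
      steps queryProgram t (natState (memory w S (index E n w)) (if z % 2 = 0 then 35 else 31)
        (Function.update (Function.update R₁ 13 2) 11 (z % 2)) o) := by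
    intro t
    rw [add_comm,
      steps_bin_add 1 1 rfl (by simp [h3]) (by simp [h3]),
      steps_bin_mod z 2 rfl (by simp [h1]) (by simp) (by omega) (by omega),
      steps_jumpEq (z % 2) 0 rfl (by simp) (by simp [h12]) (by omega) (by omega)]
  -- Either the sentinel is reached and the program halts, or the predecessor is odd and yields an
  -- answer.
  rcases hez.eq_or_lt with hez' | hez'
  · refine ⟨[], List.nodup_nil, fun x => ?_, Function.update (Function.update R₁ 13 2) 11 (z % 2),
      t₁ + (3 + 0), by simp; omega,
      steps_trans hs₁ ?_⟩
    · simp only [List.not_mem_nil, false_iff, not_and]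
      intro hx hxy hE
      have := hmax _ hxy hE
      omega
    · rw [parity, if_pos (by rw [← hez']; exact he.even), steps, List.map_nil, List.append_nil]
  · have hodd := he.odd z hez' hzle hzE
    have hR₂ : LoopRegs n l (z - 1) (Function.update (Function.update (Function.update
        (Function.update R₁ 13 2) 11 (z % 2)) 11 (z / 2)) 1 (z - 1)) := by
      constructor <;> simp [*]
    obtain ⟨xs, hnd, hxs, R', t₂, ht₂, hs₂⟩ := ih (z - 1) (by omega) (by omega)
      ⟨he.even, he.mem, by omega, fun x hx hxz => he.odd x hx (by omega)⟩ hR₂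
      (o ++ [BitVec.ofNat w (z / 2)])
    have hz2 : 2 * (z / 2) + 1 = z := by omega
    refine ⟨z / 2 :: xs, ?_, fun x => ?_, R', t₁ + ((3 + 4) + t₂), ?_,
      steps_trans hs₁ (steps_trans (s' := natState (memory w S (index E n w)) 9 _ _) ?_ hs₂) |>.trans
        (by simp)⟩
    · refine List.nodup_cons.2 ⟨fun h => ?_, hnd⟩
      have := ((hxs _).1 h).2.1
      omega
    · rw [List.mem_cons, hxs]
      constructor
      · rintro (rfl | ⟨ha, hb, hc⟩)
        · rw [hz2]; exact ⟨hez', hzle, hzE⟩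
        · exact ⟨ha, by omega, hc⟩
      · rintro ⟨ha, hb, hc⟩
        have := hmax _ hb hc
        by_cases hx : x = z / 2
        · exact Or.inl hx
        · exact Or.inr ⟨ha, by omega, hc⟩
    · simp only [List.length_cons]; omega
    · rw [parity, if_neg (by omega),
        steps_bin_div z 2 rfl (by simp [h1]) (by simp) (by omega) (by omega),
        steps_out (z / 2) rfl (by simp),
        steps_bin_sub z 1 rfl (by simp [h1]) (by simp [h3]) (by omega) (by omega),
        steps_jump rfl, steps]

theorem exists_steps_query (hw : 2 * Nat.log 2 n + 10 ≤ w) (l r : Fin n) {e : ℕ}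
    (he : IsEvenPred (E l) (2 * r + 1) e) :
    ∃ xs : List ℕ, xs.Nodup ∧
      (∀ x, x ∈ xs ↔ e < 2 * x + 1 ∧ 2 * x + 1 ≤ 2 * r + 1 ∧ E l (2 * x + 1)) ∧
      ∃ s' : State w, ∃ t ≤ 24 * (xs.length + 1) + 9,
        HaltsIn queryProgram (initState w S (index E n w) l r) t s' ∧
          s'.mem = memory w S (index E n w) ∧ s'.out = xs.map (BitVec.ofNat w) := by
  obtain ⟨R, hR, hs⟩ := steps_prelude S E hw l r
  obtain ⟨xs, hnd, hxs, R', t, ht, hs'⟩ :=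
    steps_loop S E hw l.isLt (2 * r + 1) (by omega) he hR []
  exact ⟨xs, hnd, hxs, _, 9 + t, by omega, ⟨steps_trans hs hs', rfl⟩, rfl, List.nil_append _⟩

end Query

/-! ### Modes of the prefixes of a range -/

section Prefix

variable {α : Type*} [DecidableEq α] {n : ℕ} (S : Fin n → α)

theorem count_rangeMultiset (l r : Fin n) (a : α) :
    (rangeMultiset S l r).count a = ((Finset.Icc l r).filter fun i => a = S i).card := by
  rw [rangeMultiset, Multiset.count_map]
  rfl

theorem count_le_modeFreq {l r j : Fin n} (hj : j ∈ Finset.Icc l r) :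
    (rangeMultiset S l r).count (S j) ≤ modeFreq S l r :=
  Finset.le_sup (f := fun j => (rangeMultiset S l r).count (S j)) hj

theorem isMode_iff {l r x : Fin n} (hx : x ∈ Finset.Icc l r) :
    IsMode (rangeMultiset S l r) (S x) ↔
      (rangeMultiset S l r).count (S x) = modeFreq S l r := by
  constructor
  · rintro ⟨-, h⟩
    refine le_antisymm (count_le_modeFreq S hx) (Finset.sup_le fun j hj => h _ ?_)
    exact Multiset.mem_map_of_mem S hj
  · refine fun h => ⟨Multiset.mem_map_of_mem S hx, fun y hy => ?_⟩
    obtain ⟨j, hj, rfl⟩ := Multiset.mem_map.1 hy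
    rw [h]
    exact count_le_modeFreq S hj

theorem count_mono {l r r' : Fin n} (h : r ≤ r') (a : α) :
    (rangeMultiset S l r).count a ≤ (rangeMultiset S l r').count a := by
  rw [count_rangeMultiset, count_rangeMultiset]
  exact Finset.card_le_card (Finset.filter_subset_filter _ (Finset.Icc_subset_Icc_right h))

theorem modeFreq_mono {l r r' : Fin n} (h : r ≤ r') : modeFreq S l r ≤ modeFreq S l r' :=
  Finset.sup_le fun _ hj =>
    (count_mono S h _).trans (count_le_modeFreq S (Finset.Icc_subset_Icc_right h hj))

theorem count_eq_iff {l x r : Fin n} (hlx : l ≤ x) (hxr : x ≤ r) (a : α) :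
    (rangeMultiset S l x).count a = (rangeMultiset S l r).count a ↔
      ∀ j ∈ Finset.Ioc x r, a ≠ S j := by
  rw [count_rangeMultiset, count_rangeMultiset]
  have hsub := Finset.filter_subset_filter (fun i => a = S i)
    (Finset.Icc_subset_Icc_right (a := l) hxr)
  constructor
  · intro h j hj ha
    have heq := Finset.eq_of_subset_of_card_le hsub h.ge
    rw [Finset.mem_Ioc] at hj
    have hmem : j ∈ (Finset.Icc l r).filter fun i => a = S i := by
      simp [ha, hj.2, hlx.trans hj.1.le]
    rw [← heq] at hmem
    simp only [Finset.mem_filter, Finset.mem_Icc] at hmem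
    exact absurd hj.1 (not_lt.2 hmem.1.2)
  · intro h
    congr 1
    refine hsub.antisymm fun j hj => ?_
    simp only [Finset.mem_filter, Finset.mem_Icc] at hj ⊢
    refine ⟨⟨hj.1.1, not_lt.1 fun hxj => ?_⟩, hj.2⟩
    exact h j (Finset.mem_Ioc.2 ⟨hxj, hj.1.2⟩) hj.2

theorem modeIndexSet_eq (l r : Fin n) :
    modeIndexSet S l r = (Finset.Icc l r).filter fun x =>
      modeFreq S l x = modeFreq S l r ∧ modeBit S l x = true := by
  refine Finset.filter_congr fun x hx => ?_
  obtain ⟨hlx, hxr⟩ := Finset.mem_Icc.1 hx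
  have hx' : x ∈ Finset.Icc l x := Finset.mem_Icc.2 ⟨hlx, le_rfl⟩
  rw [modeBit, decide_eq_true_iff, isMode_iff S hx, isMode_iff S hx',
    ← count_eq_iff S hlx hxr]
  have h1 := count_le_modeFreq S hx
  have h2 := count_le_modeFreq S hx'
  have h3 := modeFreq_mono S (l := l) hxr
  have h4 := count_mono S (l := l) hxr (S x)
  simp only [hlx, true_and]
  omega

theorem modeIndexSet_nonempty {l r : Fin n} (h : l ≤ r) : (modeIndexSet S l r).Nonempty := by
  -- Take a character attaining the maximum, then its last occurrence.
  obtain ⟨j, hj, hsup⟩ := Finset.exists_mem_eq_sup (Finset.Icc l r)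
    ⟨l, Finset.mem_Icc.2 ⟨le_rfl, h⟩⟩ fun j => (rangeMultiset S l r).count (S j)
  have hne : ((Finset.Icc l r).filter fun i => S j = S i).Nonempty :=
    ⟨j, Finset.mem_filter.2 ⟨hj, rfl⟩⟩
  obtain ⟨hm, hS⟩ := Finset.mem_filter.1 (Finset.max'_mem _ hne)
  refine ⟨_, Finset.mem_filter.2 ⟨hm, ?_, fun i hi hSi => ?_⟩⟩
  · rw [isMode_iff S hm, ← hS]
    exact hsup.symm
  · rw [Finset.mem_Ioc] at hi
    refine absurd (Finset.le_max' _ i (Finset.mem_filter.2 ⟨?_, hS.trans hSi⟩)) (not_le.2 hi.1)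
    exact Finset.mem_Icc.2 ⟨(Finset.mem_Icc.1 hm).1.trans hi.1.le, hi.2⟩

/-- Row `l` of the index: it holds `2 * x + 1` if `B[l][x] = 1`, and `2 * x` if `x` is the first
position with its value of `f(l, ·)`. -/
def modeEvents (l z : ℕ) : Prop :=
  ∃ i x : Fin n, (i : ℕ) = l ∧ (z = 2 * x + 1 ∧ modeBit S i x = true ∨
    z = 2 * x ∧ i ≤ x ∧ ∀ j, i ≤ j → j < x → modeFreq S i j ≠ modeFreq S i x)

theorem modeEvents_odd (l x : Fin n) : modeEvents S l (2 * x + 1) ↔ modeBit S l x = true := by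
  constructor
  · rintro ⟨i, y, hi, ⟨hy, h⟩ | ⟨hy, -⟩⟩
    · obtain rfl : i = l := Fin.ext hi
      obtain rfl : x = y := Fin.ext (by omega)
      exact h
    · omega
  · exact fun h => ⟨l, x, rfl, Or.inl ⟨rfl, h⟩⟩

/-- Let `x₀` be the first position where `f(l, ·)` reaches `f(l, r)`. Minimality makes it a marker;
by monotonicity `f(l, ·)` is constant on `[x₀, r]`, so no later marker occurs up to `r`. -/
theorem exists_isEvenPred {l r : Fin n} (h : l ≤ r) :
    ∃ x₀ : Fin n, IsEvenPred (modeEvents S l) (2 * r + 1) (2 * x₀) ∧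
      ∀ x ≤ r, x₀ ≤ x ↔ l ≤ x ∧ modeFreq S l x = modeFreq S l r := by
  have hne : ((Finset.Icc l r).filter fun x => modeFreq S l x = modeFreq S l r).Nonempty :=
    ⟨r, Finset.mem_filter.2 ⟨Finset.mem_Icc.2 ⟨h, le_rfl⟩, rfl⟩⟩
  obtain ⟨hm, hf⟩ := Finset.mem_filter.1 (Finset.min'_mem _ hne)
  have hmin : ∀ x, l ≤ x → x ≤ r → modeFreq S l x = modeFreq S l r → Finset.min' _ hne ≤ x :=
    fun x hlx hxr hx => Finset.min'_le _ x
      (Finset.mem_filter.2 ⟨Finset.mem_Icc.2 ⟨hlx, hxr⟩, hx⟩)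
  set x₀ := Finset.min' _ hne
  obtain ⟨hlx₀, hx₀r⟩ := Finset.mem_Icc.1 hm
  have hconst : ∀ x, x₀ ≤ x → x ≤ r → modeFreq S l x = modeFreq S l r := fun x hx hxr =>
    le_antisymm (modeFreq_mono S hxr) (hf ▸ modeFreq_mono S hx)
  refine ⟨x₀, ⟨by omega, ⟨l, x₀, rfl, Or.inr ⟨rfl, hlx₀, fun j hlj hj hfj => ?_⟩⟩, ?_, ?_⟩, ?_⟩
  · exact absurd (hmin j hlj (hj.le.trans hx₀r) (hfj.trans hf)) (not_le.2 hj)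
  · have : (x₀ : ℕ) ≤ r := hx₀r
    omega
  · rintro z hz hzr ⟨i, x, hi, ⟨rfl, -⟩ | ⟨rfl, -, hx⟩⟩
    · omega
    · obtain rfl : i = l := Fin.ext hi
      have hx₀x : x₀ < x := Fin.lt_def.2 (by omega)
      have hxr : x ≤ r := Fin.le_def.2 (by omega)
      exact absurd (hf.trans (hconst x hx₀x.le hxr).symm) (hx x₀ hlx₀ hx₀x)
  · exact fun x hxr => ⟨fun hx => ⟨hlx₀.trans hx, hconst x hx hxr⟩,
      fun hx => hmin x hx.1 hxr hx.2⟩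

end Prefix

/-! ### Assembly of the bounds -/

theorem answersIn_queryProgram {n σ w : ℕ} (hw : 2 * Nat.log 2 n + 10 ≤ w) (S : Fin n → Fin σ)
    {l r : Fin n} (h : l ≤ r) :
    ∃ t ≤ 57 * (modeIndexSet S l r).card,
      AnswersIn w queryProgram S (index (modeEvents S) n w) l r t := by
  obtain ⟨x₀, he, hx₀⟩ := exists_isEvenPred S h
  obtain ⟨xs, hnd, hxs, s', t, ht, hhalt, hmem, hout⟩ :=
    exists_steps_query S (modeEvents S) hw l r he
  have hn : n < 2 ^ w := (Nat.le_add_right _ _).trans_lt (add_indexLength_lt hw)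
  have hmemxs : ∀ v, v ∈ xs ↔ ∃ x ∈ modeIndexSet S l r, (x : ℕ) = v := by
    intro v
    rw [hxs, modeIndexSet_eq]
    constructor
    · rintro ⟨h1, h2, h3⟩
      lift v to Fin n using (by omega)
      have hvr : v ≤ r := Fin.le_def.2 (by omega)
      have hv := (hx₀ v hvr).1 (Fin.le_def.2 (by omega))
      exact ⟨v, Finset.mem_filter.2 ⟨Finset.mem_Icc.2 ⟨hv.1, hvr⟩, hv.2,
        (modeEvents_odd S l v).1 h3⟩, rfl⟩
    · rintro ⟨x, hx, rfl⟩
      obtain ⟨hm, hf, hB⟩ := Finset.mem_filter.1 hx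
      obtain ⟨hlx, hxr⟩ := Finset.mem_Icc.1 hm
      have h1 : (x₀ : ℕ) ≤ x := (hx₀ x hxr).2 ⟨hlx, hf⟩
      have h2 : (x : ℕ) ≤ r := hxr
      exact ⟨by omega, by omega, (modeEvents_odd S l x).2 hB⟩
  have hlt : ∀ v ∈ xs, v < 2 ^ w := fun v hv => by
    obtain ⟨x, -, rfl⟩ := (hmemxs v).1 hv
    exact x.isLt.trans hn
  have hcard : xs.length = (modeIndexSet S l r).card := by
    rw [← List.toFinset_card_of_nodup hnd, ← Finset.card_map Fin.valEmbedding]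
    congr 1
    ext v
    simp [hmemxs]
  have hpos := Finset.card_pos.2 (modeIndexSet_nonempty S h)
  have hmap : s'.out.map BitVec.toNat = xs := by
    rw [hout, List.map_map]
    exact (List.map_congr_left fun v hv => by simp [Nat.mod_eq_of_lt (hlt v hv)]).trans
      (List.map_id xs)
  -- With `m ≥ 1` answers, `24 * (m + 1) + 9 ≤ 57 * m`.
  refine ⟨t, by omega, s', hhalt, hmem, List.Nodup.of_map BitVec.toNat (hmap ▸ hnd), ?_⟩
  rwa [hmap]

end RangeMode

theorem mainTheorem9 :
    (∀ (n σ : ℕ) (S : Fin n → Fin σ) (l r : Fin n), l ≤ r →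
      RangeMode.modeIndexSet S l r =
        (Finset.Icc l r).filter fun x =>
          RangeMode.modeFreq S l x = RangeMode.modeFreq S l r ∧
            RangeMode.modeBit S l x = true) ∧
    ∃ (P : RangeMode.Program) (T : ℕ), ∀ κ : ℕ, ∃ c : ℕ,
      ∀ n w σ : ℕ, 2 * Nat.log 2 n + 10 ≤ w → w ≤ κ * (Nat.log 2 n + 1) → σ ≤ 2 ^ w →
        ∀ S : Fin n → Fin σ, ∃ D : List (BitVec w), D.length * w ≤ c * n ^ 2 ∧
          ∀ l r : Fin n, l ≤ r →
            ∃ t ≤ T * (RangeMode.modeIndexSet S l r).card,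
              RangeMode.AnswersIn w P S D l r t := by
  refine ⟨fun n σ S l r _ => RangeMode.modeIndexSet_eq S l r, RangeMode.queryProgram, 57,
    fun κ => ⟨15 * κ, fun n w σ hw hwκ _ S => ?_⟩⟩
  exact ⟨RangeMode.index (RangeMode.modeEvents S) n w, RangeMode.index_length_mul_le _ hwκ,
    fun l r h => RangeMode.answersIn_queryProgram hw S h⟩
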